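/- Let $K$ be a field, $r\in\mathbb N$, and let $\mathbf R^r=[0,\infty)^r$ be partially ordered component-wise. A persistence module is a functor from the poset $\mathbf R^r$ to $K$-vector spaces; it is \emph{tame} if it is finitely presented, i.e. if there is an exact sequence $F_1\to F_0\to M\to 0$ with $F_0,F_1$ free of finite rank, where a free module of rank $n$ is a direct sum $\bigoplus_{i=1}^n K(g_i,\bullet)$ with $K(g,h)=K$ if $g\le h$ and $0$ otherwise. For a tame module $M$, let $\beta_0(M)$ be the smallest rank of a free persistence module surjecting onto $M$. For $u\in\mathbf R^r$, the \emph{shift-dimension} $\dim_u(M)$ is the smallest $k$ such that there are homogeneous elements $m_1,\dots,m_k$ of $M$ with $u*(M/\langle m_1,\dots,m_k\rangle)=0$, i.e. such that all maps $(M/\langle m_1,\dots,m_k\rangle)(a)\to (M/\langle m_1,\dots,m_k\rangle)(a+u)$, $a\in\mathbf R^r$, vanish. Let $0\neq w\in\mathbf R^r$ and $v=w/\|w\|$, where $\|\cdot\|$ is any norm on $\mathbb R^r$. The \emph{standard noise} in the direction of $v$ is the noise system of the standard contour $C(x,\varepsilon)=x+\varepsilon v$, namely $$\mathcal V_\varepsilon=\{N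 \text{ tame} \mid N(a\le a+\varepsilon v)=0 \text{ for all } a\in\mathbf R^r\},\qquad \varepsilon\ge 0 .$$ A morphism $f$ of tame modules is an \emph{$\varepsilon$-equivalence} with respect to this noise system if $\ker f\in\mathcal V_a$ and $\operatorname{coker} f\in\mathcal V_b$ for some $a,b\ge 0$ with $a+b\le\varepsilon$. Tame modules $M,N$ are \emph{$\varepsilon$-equivalent} if there are a tame module $L$, an $\varepsilon_1$-equivalence $M\to L$ and an $\varepsilon_2$-equivalence $N\to L$ with $\varepsilon_1+\varepsilon_2\le\varepsilon$. Let $d(M,N)\in[0,\infty]$ be the infimum of all $\varepsilon\geq 0$ such that $M$ and $N$ are $\varepsilon$-equivalent ($\infty$ if there is none). Then the hierarchical stabilization $\widehat{\beta_0}$ of $\beta_0$ with respect to $d$ satisfies, for every tame module $M$ and every $\delta\ge 0$, $$\widehat{\beta_0}(M)(\delta)\;:=\;\min\{\beta_0(N)\mid N\text{ tame},\ d(M,N)\le\delta\}\;=\;\dim_{\delta v}(M).$$ -/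

import Mathlib

open CategoryTheory
open scoped NNReal ENNReal

universe u

namespace MultiPers

/-- The poset `𝐑^r = [0, ∞)^r` with the component-wise order, addition and scaling. It is a `def`
so that its category structure is the one of the poset, not the product of categories. -/
def Grade (r : ℕ) : Type := Fin r → ℝ≥0

noncomputable instance (r : ℕ) : AddCommMonoid (Grade r) :=
  inferInstanceAs (AddCommMonoid (Fin r → ℝ≥0))

instance (r : ℕ) : PartialOrder (Grade r) := inferInstanceAs (PartialOrder (Fin r → ℝ≥0))

instance (r : ℕ) : IsOrderedAddMonoid (Grade r) :=
  inferInstanceAs (IsOrderedAddMonoid (Fin r → ℝ≥0))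

instance (r : ℕ) : CanonicallyOrderedAdd (Grade r) :=
  inferInstanceAs (CanonicallyOrderedAdd (Fin r → ℝ≥0))

noncomputable instance (r : ℕ) : Module ℝ≥0 (Grade r) :=
  inferInstanceAs (Module ℝ≥0 (Fin r → ℝ≥0))

/-- Persistence modules over `𝐑^r`: functors from the poset `𝐑^r` to `K`-vector spaces. -/
abbrev PersMod (K : Type u) [Field K] (r : ℕ) : Type (u + 1) := Grade r ⥤ ModuleCat.{u} K

section Modules

variable {K : Type u} [Field K] {r : ℕ}

/-- The value at `h` of the free module `⨁ i, K(g i, •)`: families of scalars whose `i`-th entry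
is arbitrary if `g i ≤ h` and zero otherwise. -/
def freeFiber (K : Type u) [Field K] {r n : ℕ} (g : Fin n → Grade r) (h : Grade r) :
    Submodule K (Fin n → K) where
  carrier := {c | ∀ i, ¬ g i ≤ h → c i = 0}
  add_mem' := by
    intro a b ha hb i hi
    simp [ha i hi, hb i hi]
  zero_mem' := by
    intro i _
    rfl
  smul_mem' := by
    intro c a ha i hi
    simp [ha i hi]

theorem freeFiber_mono {n : ℕ} (g : Fin n → Grade r) {h h' : Grade r} (hh : h ≤ h') :
    freeFiber K g h ≤ freeFiber K g h' :=
  fun _ hc i hi => hc i fun hg => hi (hg.trans hh)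

/-- The free persistence module `⨁ i, K(g i, •)` of rank `n`, with one homogeneous free generator
in each of the degrees `g 0, …, g (n - 1)`. -/
def freeMod (K : Type u) [Field K] {r n : ℕ} (g : Fin n → Grade r) : PersMod K r where
  obj h := ModuleCat.of K (freeFiber K g h)
  map f := ModuleCat.ofHom (Submodule.inclusion (freeFiber_mono g (leOfHom f)))
  map_id _ := rfl
  map_comp _ _ := rfl

/-- A morphism of persistence modules is surjective if all of its components are. -/
def IsSurj {M N : PersMod K r} (f : M ⟶ N) : Prop :=
  ∀ h : Grade r, Function.Surjective (f.app h).hom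

/-- Tame persistence modules: the finitely presented ones, i.e. those with an exact sequence
`F₁ ⟶ F₀ ⟶ M ⟶ 0` where `F₀` and `F₁` are free of finite rank. -/
def IsTame (M : PersMod K r) : Prop :=
  ∃ (n m : ℕ) (g : Fin n → Grade r) (g' : Fin m → Grade r)
    (q : freeMod K g' ⟶ freeMod K g) (p : freeMod K g ⟶ M),
    IsSurj p ∧ ∀ h : Grade r, LinearMap.range (q.app h).hom = LinearMap.ker (p.app h).hom

/-- The tame persistence modules over `𝐑^r`. -/
def TameMod (K : Type u) [Field K] (r : ℕ) : Type (u + 1) := {M : PersMod K r // IsTame M}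

/-- The zeroth total multigraded Betti number of `M`: the smallest rank of a free persistence
module that surjects onto `M`. -/
noncomputable def betti0 (M : PersMod K r) : ℕ :=
  sInf {n : ℕ | ∃ (g : Fin n → Grade r) (p : freeMod K g ⟶ M), IsSurj p}

/-- Persistence submodules (subfunctors) of `M`. -/
structure PersSub (M : PersMod K r) where
  /-- the subspace in degree `h` -/
  fiber : ∀ h : Grade r, Submodule K (M.obj h)
  fiber_le_comap : ∀ {h h' : Grade r} (f : h ⟶ h'),
    fiber h ≤ (fiber h').comap (M.map f).hom

/-- The quotient persistence module `M / U`. -/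
def PersSub.quotient {M : PersMod K r} (U : PersSub M) : PersMod K r where
  obj h := ModuleCat.of K (M.obj h ⧸ U.fiber h)
  map {h h'} f := ModuleCat.ofHom
    (Submodule.mapQ (U.fiber h) (U.fiber h') (M.map f).hom (U.fiber_le_comap f))
  map_id h := by
    ext x
    simp
  map_comp f f' := by
    ext x
    simp

/-- The submodule `⟨m₁, …, m_k⟩` of `M` generated by homogeneous elements `m i` of degree `g i`:
in degree `h` it is spanned by the images of those `m i` with `g i ≤ h`. -/
def generated (M : PersMod K r) {k : ℕ} (g : Fin k → Grade r) (m : ∀ i, M.obj (g i)) :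
    PersSub M where
  fiber h := Submodule.span K {y | ∃ (i : Fin k) (hi : g i ≤ h), y = M.map (homOfLE hi) (m i)}
  fiber_le_comap {h h'} f := by
    rw [Submodule.span_le]
    rintro y ⟨i, hi, rfl⟩
    refine Submodule.subset_span ⟨i, hi.trans (leOfHom f), ?_⟩
    change (M.map f) (M.map (homOfLE hi) (m i)) = _
    rw [← ConcreteCategory.comp_apply, ← M.map_comp]
    rfl

/-- `v ∗ M = 0`: the action of `v` on `M`, which sends `M(a)` to `M(a + v)`, is zero. -/
def ShiftZero (v : Grade r) (M : PersMod K r) : Prop :=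
  ∀ a : Grade r, M.map (homOfLE (le_self_add : a ≤ a + v)) = 0

/-- Homogeneous elements `m₁, …, m_k` `v`-generate `M` if `v ∗ (M / ⟨m₁, …, m_k⟩) = 0`. -/
def VGenerate (v : Grade r) (M : PersMod K r) {k : ℕ} (g : Fin k → Grade r)
    (m : ∀ i, M.obj (g i)) : Prop :=
  ShiftZero v (generated M g m).quotient

/-- The shift-dimension `dim_v(M)`: the smallest number of homogeneous elements that
`v`-generate `M`. -/
noncomputable def shiftDim (v : Grade r) (M : PersMod K r) : ℕ :=
  sInf {k : ℕ | ∃ (g : Fin k → Grade r) (m : ∀ i, M.obj (g i)), VGenerate v M g m}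

end Modules

/-- Persistence contours: functors `C : 𝐑^r_∞ × 𝐑 → 𝐑^r_∞` with `x ≤ C(x, ε)` and
`C(C(x, ε), τ) ≤ C(x, ε + τ)`. -/
structure Contour (r : ℕ) where
  /-- the underlying map -/
  toFun : WithTop (Grade r) → ℝ≥0 → WithTop (Grade r)
  mono : ∀ {x y : WithTop (Grade r)} {ε τ : ℝ≥0}, x ≤ y → ε ≤ τ → toFun x ε ≤ toFun y τ
  le : ∀ (x : WithTop (Grade r)) (ε : ℝ≥0), x ≤ toFun x ε
  lax : ∀ (x : WithTop (Grade r)) (ε τ : ℝ≥0), toFun (toFun x ε) τ ≤ toFun x (ε + τ)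

/-- The standard contour `C(x, ε) = x + ε v` in the direction of `v`. -/
noncomputable def standardContour {r : ℕ} (v : Grade r) : Contour r where
  toFun x ε := x + ((ε • v : Grade r) : WithTop (Grade r))
  mono {x y ε τ} hxy hετ := by
    refine add_le_add hxy (WithTop.coe_le_coe.2 fun i => ?_)
    exact mul_le_mul_left hετ (v i)
  le x ε := le_self_add
  lax x ε τ := by
    rw [add_assoc, ← WithTop.coe_add, ← add_smul]

section Noise

variable {K : Type u} [Field K] {r : ℕ}

/-- The noise system of a contour: the `ε`-th component consists of the tame modules `N` such that
`N(x ≤ C(x, ε))` is zero whenever `C(x, ε) ≠ ∞`. -/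
def contourNoise (K : Type u) [Field K] {r : ℕ} (C : Contour r) (ε : ℝ≥0) : Set (PersMod K r) :=
  {N | IsTame N ∧ ∀ (x y : Grade r) (hxy : x ≤ y),
    C.toFun (x : WithTop (Grade r)) ε = (y : WithTop (Grade r)) → N.map (homOfLE hxy) = 0}

/-- The standard noise in the direction of `v`. -/
def standardNoise (K : Type u) [Field K] {r : ℕ} (v : Grade r) : ℝ≥0 → Set (PersMod K r) :=
  contourNoise K (standardContour v)

/-- With respect to a noise system `V`, a morphism `f` is an `ε`-equivalence if `ker f ∈ V a` and
`coker f ∈ V b` for some `a`, `b` with `a + b ≤ ε`. -/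
def IsEquivalence (V : ℝ≥0 → Set (PersMod K r)) (ε : ℝ≥0) {M N : PersMod K r}
    (f : M ⟶ N) : Prop :=
  ∃ a b : ℝ≥0, a + b ≤ ε ∧ Limits.kernel f ∈ V a ∧ Limits.cokernel f ∈ V b

/-- Tame modules `M`, `N` are `ε`-equivalent if there are a tame module `L` and an
`ε₁`-equivalence `M ⟶ L` and an `ε₂`-equivalence `N ⟶ L` with `ε₁ + ε₂ ≤ ε`. -/
def AreEquivalent (V : ℝ≥0 → Set (PersMod K r)) (ε : ℝ≥0) (M N : TameMod K r) : Prop :=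
  ∃ (L : TameMod K r) (f : M.1 ⟶ L.1) (g : N.1 ⟶ L.1) (ε₁ ε₂ : ℝ≥0),
    IsEquivalence V ε₁ f ∧ IsEquivalence V ε₂ g ∧ ε₁ + ε₂ ≤ ε

/-- The extended pseudometric of a noise system: the infimum of all `ε` such that `M` and `N` are
`ε`-equivalent (and `∞` if there are none). -/
noncomputable def noiseDist (V : ℝ≥0 → Set (PersMod K r)) (M N : TameMod K r) : ℝ≥0∞ :=
  ⨅ (ε : ℝ≥0) (_ : AreEquivalent V ε M N), (ε : ℝ≥0∞)

end Noise

/-- The hierarchical stabilization of `f : T → ℕ` with respect to an extended pseudometric `d`: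
`x ↦ (τ ↦ min {f y | d x y ≤ τ})`. -/
noncomputable def hierStab {T : Type*} (d : T → T → ℝ≥0∞) (f : T → ℕ) (x : T) (τ : ℝ≥0) : ℕ :=
  sInf {n : ℕ | ∃ y : T, d x y ≤ (τ : ℝ≥0∞) ∧ f y = n}

/-- The normalization `w / ‖w‖` of a vector `w ∈ 𝐑^r` for a norm on `ℝ^r`. -/
noncomputable def normalize {r : ℕ} (nrm : Seminorm ℝ (Fin r → ℝ)) (w : Grade r) : Grade r :=
  (Real.toNNReal (nrm fun i => (w i : ℝ)))⁻¹ • w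

end MultiPers

/-!
A free cover of `N` of rank `k` is the same as a `k`-tuple of homogeneous generators of `N`.

Homogeneous elements that `δv`-generate `M` span a submodule whose inclusion into `M` is injective
with cokernel killed by `δv`; this submodule is `δ`-close to `M`, so `β̂₀(M)(δ) ≤ dim_{δv}(M)`.
Conversely, along an `ε`-equivalence `M ⟶ L ⟵ N` generators of `N` are pushed to `L` and, after a
shift, lifted to elements of `M` that `εv`-generate it.

If `d(M, N) ≤ δ`, this only gives `dim_{εv}(M) ≤ β₀(N)` for every `ε > δ`. The step to `ε = δ` uses
that a tame module is constant on the cells of a finite grid: generators may be moved to the lower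
corners of their cells, and the finitely many corners shifted by `εv` stay, for `ε > δ` close to
`δ`, in the cells they occupy for `ε = δ`.
-/

namespace MultiPers

open scoped Topology

universe w

section Transition

variable {P : Type*} [Preorder P] {R : Type*} [Ring R] {M N : P ⥤ ModuleCat.{w} R}

/-- The structure map `M(a ≤ b)` of a functor `M` on a poset, as a linear map. -/
def transition (M : P ⥤ ModuleCat.{w} R) {a b : P} (h : a ≤ b) : M.obj a →ₗ[R] M.obj b :=
  (M.map (homOfLE h)).hom

theorem transition_transition (M : P ⥤ ModuleCat.{w} R) {a b c : P} (hab : a ≤ b) (hbc : b ≤ c)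
    (x : M.obj a) : transition M hbc (transition M hab x) = transition M (hab.trans hbc) x :=
  (congrArg (fun t => t.hom x) (M.map_comp (homOfLE hab) (homOfLE hbc))).symm

theorem transition_self (M : P ⥤ ModuleCat.{w} R) {a : P} (h : a ≤ a) (x : M.obj a) :
    transition M h x = x :=
  congrArg (fun t => t.hom x) (M.map_id a)

theorem app_transition (f : M ⟶ N) {a b : P} (h : a ≤ b) (x : M.obj a) :
    (f.app b).hom (transition M h x) = transition N h ((f.app a).hom x) :=
  congrArg (fun t => t.hom x) (f.naturality (homOfLE h))

theorem map_homOfLE_eq_zero_iff {a b : P} (h : a ≤ b) :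
    M.map (homOfLE h) = 0 ↔ ∀ x, transition M h x = 0 :=
  ModuleCat.hom_ext_iff.trans LinearMap.ext_iff

end Transition

section Exactness

variable {D : Type*} [Category* D] {R : Type*} [Ring R] {M N : D ⥤ ModuleCat.{w} R}

theorem range_kernel_ι_app (f : M ⟶ N) (a : D) :
    LinearMap.range ((Limits.kernel.ι f).app a).hom = LinearMap.ker (f.app a).hom :=
  ((ShortComplex.exact_kernel f).map
    ((evaluation D (ModuleCat.{w} R)).obj a)).moduleCat_range_eq_ker

theorem range_app_eq_ker_cokernel_π (f : M ⟶ N) (a : D) :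
    LinearMap.range (f.app a).hom = LinearMap.ker ((Limits.cokernel.π f).app a).hom :=
  ((ShortComplex.exact_cokernel f).map
    ((evaluation D (ModuleCat.{w} R)).obj a)).moduleCat_range_eq_ker

theorem injective_app_of_mono (f : M ⟶ N) [Mono f] (a : D) : Function.Injective (f.app a).hom :=
  (ModuleCat.mono_iff_injective _).1 inferInstance

end Exactness

variable {K : Type u} [Field K] {r : ℕ}

section ShiftZero

variable {M N : PersMod K r}

theorem cokernel_π_isSurj (f : M ⟶ N) : IsSurj (Limits.cokernel.π f) :=
  fun _ => (ModuleCat.epi_iff_surjective _).1 inferInstance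

theorem shiftZero_iff {u : Grade r} :
    ShiftZero u M ↔ ∀ (a : Grade r) (x : M.obj a),
      transition M (le_self_add : a ≤ a + u) x = 0 :=
  forall_congr' fun _ => map_homOfLE_eq_zero_iff _

theorem IsSurj.shiftZero_iff {p : M ⟶ N} (hp : IsSurj p) {u : Grade r} :
    ShiftZero u N ↔ ∀ (a : Grade r) (x : M.obj a),
      transition M (le_self_add : a ≤ a + u) x ∈ LinearMap.ker (p.app (a + u)).hom := by
  simp only [MultiPers.shiftZero_iff, (hp _).forall, LinearMap.mem_ker, app_transition]

theorem shiftZero_cokernel_iff {f : M ⟶ N} {u : Grade r} :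
    ShiftZero u (Limits.cokernel f) ↔ ∀ (a : Grade r) (x : N.obj a),
      transition N (le_self_add : a ≤ a + u) x ∈ LinearMap.range (f.app (a + u)).hom := by
  simp only [(cokernel_π_isSurj f).shiftZero_iff, range_app_eq_ker_cokernel_π]

theorem shiftZero_kernel_iff {f : M ⟶ N} {u : Grade r} :
    ShiftZero u (Limits.kernel f) ↔ ∀ (a : Grade r) (x : M.obj a), (f.app a).hom x = 0 →
      transition M (le_self_add : a ≤ a + u) x = 0 := by
  refine shiftZero_iff.trans (forall_congr' fun a => ⟨fun h x hx => ?_, fun h x => ?_⟩)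
  · obtain ⟨y, rfl⟩ := (range_kernel_ι_app f a).ge hx
    rw [← app_transition, h, map_zero]
  · apply injective_app_of_mono (Limits.kernel.ι f)
    rw [app_transition, map_zero]
    exact h _ ((range_kernel_ι_app f a).le ⟨x, rfl⟩)

end ShiftZero

namespace PersSub

variable {M : PersMod K r} (U : PersSub M)

theorem transition_mem {a b : Grade r} (h : a ≤ b) {x : M.obj a} (hx : x ∈ U.fiber a) :
    transition M h x ∈ U.fiber b :=
  U.fiber_le_comap (homOfLE h) hx

/-- A persistence submodule, viewed as a persistence module. -/
def toMod : PersMod K r where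
  obj h := ModuleCat.of K (U.fiber h)
  map f := ModuleCat.ofHom ((M.map f).hom.restrict fun _ hx => U.fiber_le_comap f hx)
  map_id h := ModuleCat.hom_ext <| LinearMap.ext fun x =>
    Subtype.ext <| congrArg (fun t => t.hom x.1) (M.map_id h)
  map_comp f f' := ModuleCat.hom_ext <| LinearMap.ext fun x =>
    Subtype.ext <| congrArg (fun t => t.hom x.1) (M.map_comp f f')

/-- The inclusion `U ⟶ M` of a persistence submodule. -/
def ι : U.toMod ⟶ M where
  app h := ModuleCat.ofHom (U.fiber h).subtype
  naturality _ _ _ := rfl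

theorem ι_app_injective (h : Grade r) : Function.Injective (U.ι.app h).hom :=
  Subtype.val_injective

theorem range_ι_app (h : Grade r) : LinearMap.range (U.ι.app h).hom = U.fiber h :=
  (U.fiber h).range_subtype

instance mono_ι : Mono U.ι :=
  have (h : Grade r) : Mono (U.ι.app h) :=
    (ModuleCat.mono_iff_injective _).2 (U.ι_app_injective h)
  NatTrans.mono_of_mono_app _

/-- The projection `M ⟶ M / U` onto the quotient by a persistence submodule. -/
def π : M ⟶ U.quotient where
  app h := ModuleCat.ofHom (U.fiber h).mkQ
  naturality _ _ _ := rfl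

theorem π_isSurj : IsSurj U.π :=
  fun h => (U.fiber h).mkQ_surjective

theorem ker_π_app (h : Grade r) : LinearMap.ker (U.π.app h).hom = U.fiber h :=
  (U.fiber h).ker_mkQ

theorem shiftZero_quotient_iff {u : Grade r} :
    ShiftZero u U.quotient ↔ ∀ (a : Grade r) (x : M.obj a),
      transition M (le_self_add : a ≤ a + u) x ∈ U.fiber (a + u) := by
  simp only [U.π_isSurj.shiftZero_iff, ker_π_app]

theorem shiftZero_cokernel_ι_iff {u : Grade r} :
    ShiftZero u (Limits.cokernel U.ι) ↔ ShiftZero u U.quotient := by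
  simp only [shiftZero_cokernel_iff, shiftZero_quotient_iff, range_ι_app]

theorem transition_mem_of_app_mem_map {L : PersMod K r} {f : M ⟶ L} {u : Grade r}
    (hf : ShiftZero u (Limits.kernel f)) {a : Grade r} {x : M.obj a}
    (hx : (f.app a).hom x ∈ (U.fiber a).map (f.app a).hom) :
    transition M (le_self_add : a ≤ a + u) x ∈ U.fiber (a + u) := by
  obtain ⟨z, hz, hzx⟩ := hx
  have hker : (f.app a).hom (x - z) = 0 := by rw [map_sub, hzx, sub_self]
  have heq := shiftZero_kernel_iff.1 hf a _ hker
  rw [map_sub, sub_eq_zero] at heq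
  exact heq ▸ U.transition_mem _ hz

end PersSub

section Generated

variable {M N : PersMod K r} {k : ℕ} {g : Fin k → Grade r} {m : ∀ i, M.obj (g i)}

theorem transition_mem_generated (m : ∀ i, M.obj (g i)) {h : Grade r} (i : Fin k)
    (hi : g i ≤ h) : transition M hi (m i) ∈ (generated M g m).fiber h :=
  Submodule.subset_span ⟨i, hi, rfl⟩

theorem mem_generated (m : ∀ i, M.obj (g i)) (i : Fin k) :
    m i ∈ (generated M g m).fiber (g i) :=
  transition_self M le_rfl (m i) ▸ transition_mem_generated m i le_rfl

theorem generated_fiber_le {h : Grade r} {W : Submodule K (M.obj h)}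
    (hW : ∀ i (hi : g i ≤ h), transition M hi (m i) ∈ W) : (generated M g m).fiber h ≤ W := by
  refine Submodule.span_le.2 ?_
  rintro _ ⟨i, hi, rfl⟩
  exact hW i hi

theorem map_generated_fiber (f : M ⟶ N) (m : ∀ i, M.obj (g i)) (h : Grade r) :
    ((generated M g m).fiber h).map (f.app h).hom =
      (generated N g fun i => (f.app (g i)).hom (m i)).fiber h := by
  apply le_antisymm
  · refine Submodule.map_le_iff_le_comap.2 (generated_fiber_le fun i hi => ?_)
    rw [Submodule.mem_comap, app_transition]
    exact transition_mem_generated (fun i => (f.app (g i)).hom (m i)) i hi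
  · exact generated_fiber_le fun i hi =>
      ⟨_, transition_mem_generated m i hi, app_transition f hi (m i)⟩

/-- The elements `m i`, viewed as elements of the submodule they generate. -/
def generatedGen (m : ∀ i, M.obj (g i)) (i : Fin k) : (generated M g m).toMod.obj (g i) :=
  ⟨m i, mem_generated m i⟩

theorem generated_generatedGen_fiber_eq_top (m : ∀ i, M.obj (g i)) (h : Grade r) :
    (generated (generated M g m).toMod g (generatedGen m)).fiber h = ⊤ := by
  apply Submodule.map_injective_of_injective ((generated M g m).ι_app_injective h)
  rw [map_generated_fiber, Submodule.map_top, PersSub.range_ι_app]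
  rfl

theorem vGenerate_iff {u : Grade r} :
    VGenerate u M g m ↔ ∀ (a : Grade r) (x : M.obj a),
      transition M (le_self_add : a ≤ a + u) x ∈ (generated M g m).fiber (a + u) :=
  (generated M g m).shiftZero_quotient_iff

theorem VGenerate.mono {u v : Grade r} (huv : u ≤ v) (hm : VGenerate u M g m) :
    VGenerate v M g m := by
  refine vGenerate_iff.2 fun a x => ?_
  have := (generated M g m).transition_mem (add_le_add_right huv a) (vGenerate_iff.1 hm a x)
  rwa [transition_transition] at this

theorem vGenerate_of_generated_eq_top (hm : ∀ h, (generated M g m).fiber h = ⊤) (u : Grade r) :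
    VGenerate u M g m :=
  vGenerate_iff.2 fun _ _ => hm _ ▸ Submodule.mem_top

theorem shiftDim_le {u : Grade r} (hm : VGenerate u M g m) : shiftDim u M ≤ k :=
  Nat.sInf_le ⟨g, m, hm⟩

end Generated

section Free

variable {M : PersMod K r} {k : ℕ} (g : Fin k → Grade r)

theorem single_mem_freeFiber {h : Grade r} {i : Fin k} (hi : g i ≤ h) (c : K) :
    Pi.single i c ∈ freeFiber K g h := by
  intro j hj
  rw [Pi.single_eq_of_ne]
  rintro rfl
  exact hj hi

/-- The `i`-th free generator of `⨁ i, K(g i, •)`, of degree `g i`. -/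
def freeGen (i : Fin k) : (freeMod K g).obj (g i) :=
  ⟨Pi.single i 1, single_mem_freeFiber g le_rfl 1⟩

theorem generated_freeGen_fiber_eq_top (h : Grade r) :
    (generated (freeMod K g) g (freeGen g)).fiber h = ⊤ := by
  let U : Submodule K (freeFiber K g h) := (generated (freeMod K g) g (freeGen g)).fiber h
  refine eq_top_iff.2 fun (c : freeFiber K g h) _ => ?_
  suffices hc : c.1 ∈ U.map (freeFiber K g h).subtype from
    Subtype.val_injective.mem_set_image.1 hc
  rw [← Finset.univ_sum_single c.1]
  refine Submodule.sum_mem _ fun i _ => ?_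
  by_cases hi : g i ≤ h
  · have hsingle : Pi.single i (c.1 i) = c.1 i • (Pi.single i 1 : Fin k → K) := by
      rw [← Pi.single_smul, smul_eq_mul, mul_one]
    rw [hsingle]
    exact Submodule.smul_mem _ _ ⟨_, transition_mem_generated (freeGen g) i hi, rfl⟩
  · rw [c.2 i hi, Pi.single_zero]
    exact Submodule.zero_mem _

theorem range_app_eq_generated {g : Fin k → Grade r} (p : freeMod K g ⟶ M) (h : Grade r) :
    LinearMap.range (p.app h).hom =
      (generated M g fun i => (p.app (g i)).hom (freeGen g i)).fiber h := by
  rw [← map_generated_fiber, generated_freeGen_fiber_eq_top, Submodule.map_top]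

open Classical in
/-- The morphism `⨁ i, K(g i, •) ⟶ M` that sends the `i`-th free generator to `m i`. A generator
whose degree is not `≤ h` has coefficient zero in degree `h`, so the value `0` chosen for it there
is immaterial. -/
noncomputable def freeHom (m : ∀ i, M.obj (g i)) : freeMod K g ⟶ M where
  app h := ModuleCat.ofHom <|
    Fintype.linearCombination K (fun i => if hi : g i ≤ h then transition M hi (m i) else 0) ∘ₗ
      (freeFiber K g h).subtype
  naturality {h h'} f := by
    refine ModuleCat.hom_ext (LinearMap.ext fun (c : freeFiber K g h) => ?_)
    change Fintype.linearCombination K _ c.1 =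
      transition M (leOfHom f) (Fintype.linearCombination K _ c.1)
    simp only [Fintype.linearCombination_apply, map_sum, map_smul]
    refine Finset.sum_congr rfl fun i _ => ?_
    by_cases hi : g i ≤ h
    · rw [dif_pos hi, dif_pos (hi.trans (leOfHom f)), transition_transition]
    · rw [c.2 i hi, zero_smul, zero_smul]

theorem freeHom_freeGen (m : ∀ i, M.obj (g i)) (i : Fin k) :
    ((freeHom g m).app (g i)).hom (freeGen g i) = m i := by
  refine (Fintype.linearCombination_apply_single K _ i 1).trans ?_
  rw [one_smul, dif_pos le_rfl, transition_self]

theorem exists_isSurj_iff :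
    (∃ p : freeMod K g ⟶ M, IsSurj p) ↔
      ∃ m : ∀ i, M.obj (g i), ∀ h, (generated M g m).fiber h = ⊤ := by
  constructor
  · rintro ⟨p, hp⟩
    exact ⟨_, fun h => (range_app_eq_generated p h).symm.trans (LinearMap.range_eq_top.2 (hp h))⟩
  · rintro ⟨m, hm⟩
    refine ⟨freeHom g m, fun h => LinearMap.range_eq_top.1 ?_⟩
    rw [range_app_eq_generated, ← hm h]
    simp only [freeHom_freeGen]

theorem betti0_le {g : Fin k → Grade r} {m : ∀ i, M.obj (g i)}
    (hm : ∀ h, (generated M g m).fiber h = ⊤) : betti0 M ≤ k :=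
  Nat.sInf_le ⟨g, (exists_isSurj_iff g).2 ⟨m, hm⟩⟩

theorem IsTame.exists_generated_betti0 (hM : IsTame M) :
    ∃ (g : Fin (betti0 M) → Grade r) (m : ∀ i, M.obj (g i)),
      ∀ h, (generated M g m).fiber h = ⊤ := by
  have hne : {k : ℕ | ∃ (g : Fin k → Grade r) (p : freeMod K g ⟶ M), IsSurj p}.Nonempty := by
    obtain ⟨k, -, g, -, -, p, hp, -⟩ := hM
    exact ⟨k, g, p, hp⟩
  obtain ⟨g, hg⟩ := Nat.sInf_mem hne
  exact ⟨g, (exists_isSurj_iff g).1 hg⟩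

theorem IsTame.exists_vGenerate_shiftDim (hM : IsTame M) (u : Grade r) :
    ∃ (g : Fin (shiftDim u M) → Grade r) (m : ∀ i, M.obj (g i)), VGenerate u M g m := by
  obtain ⟨g, m, hm⟩ := hM.exists_generated_betti0
  exact Nat.sInf_mem (s := {k | ∃ (g : Fin k → Grade r) (m : ∀ i, M.obj (g i)), VGenerate u M g m})
    ⟨_, g, m, vGenerate_of_generated_eq_top hm u⟩

end Free

section Grid

/-- The lower corner of the cell that contains `a`, in the grid whose walls in each of the `r`
directions are at `0` and at the elements of `S`. -/
noncomputable def corner (S : Finset ℝ≥0) (a : Grade r) : Grade r :=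
  fun i => (S.filter (· ≤ a i)).sup id

theorem corner_le (S : Finset ℝ≥0) (a : Grade r) : corner S a ≤ a :=
  fun _ => Finset.sup_le fun _ hs => (Finset.mem_filter.1 hs).2

theorem le_corner_apply_iff {S : Finset ℝ≥0} {a : Grade r} {i : Fin r} {s : ℝ≥0} (hs : s ∈ S) :
    s ≤ corner S a i ↔ s ≤ a i :=
  ⟨fun h => h.trans (corner_le S a i),
    fun h => Finset.le_sup (f := id) (Finset.mem_filter.2 ⟨hs, h⟩)⟩

theorem corner_eq_corner_iff {S : Finset ℝ≥0} {a b : Grade r} :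
    corner S a = corner S b ↔ ∀ i, ∀ s ∈ S, s ≤ a i ↔ s ≤ b i := by
  refine ⟨fun h i s hs => ?_, fun h => funext fun i => ?_⟩
  · rw [← le_corner_apply_iff hs, h, le_corner_apply_iff hs]
  · exact congrArg (Finset.sup · id) (Finset.filter_congr (h i))

theorem corner_mono (S : Finset ℝ≥0) : Monotone (corner S : Grade r → Grade r) :=
  fun _ _ h i => Finset.sup_mono (Finset.monotone_filter_right S fun _ _ hs => le_trans hs (h i))

theorem corner_corner (S : Finset ℝ≥0) (a : Grade r) : corner S (corner S a) = corner S a :=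
  corner_eq_corner_iff.2 fun _ _ => le_corner_apply_iff

theorem corner_of_mem {S : Finset ℝ≥0} {a : Grade r} (ha : ∀ i, a i ∈ S) : corner S a = a :=
  le_antisymm (corner_le S a) fun i => (le_corner_apply_iff (ha i)).2 le_rfl

theorem finite_range_corner (S : Finset ℝ≥0) :
    (Set.range (corner S : Grade r → Grade r)).Finite := by
  refine (Set.Finite.pi' fun _ : Fin r => (insert 0 S).finite_toSet).subset ?_
  rintro _ ⟨a, rfl⟩ i
  rw [Finset.mem_coe, Finset.mem_insert]
  rcases (S.filter (· ≤ a i)).eq_empty_or_nonempty with hempty | hne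
  · exact Or.inl (congrArg (Finset.sup · id) hempty)
  · obtain ⟨s, hs, hsup⟩ := Finset.exists_mem_eq_sup _ hne id
    exact Or.inr ((show corner S a i = s from hsup) ▸ (Finset.mem_filter.1 hs).1)

theorem exists_finset_forall_corner_eq {k : ℕ} (g : Fin k → Grade r) :
    ∃ S : Finset ℝ≥0, ∀ T, S ⊆ T → ∀ i, corner T (g i) = g i := by
  classical
  refine ⟨Finset.univ.image fun x : Fin k × Fin r => g x.1 x.2, fun T hT i => ?_⟩
  exact corner_of_mem fun j => hT (Finset.mem_image_of_mem _ (Finset.mem_univ (i, j)))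

theorem eventually_corner_eq {α : Type*} [TopologicalSpace α] [Preorder α] (S : Finset ℝ≥0)
    {f : α → Grade r} (hf : Monotone f) {t : α}
    (hcont : ∀ i, ContinuousWithinAt (fun s => f s i) (Set.Ioi t) t) :
    ∀ᶠ s in 𝓝[>] t, corner S (f s) = corner S (f t) := by
  simp only [corner_eq_corner_iff, Filter.eventually_all, Filter.eventually_all_finset]
  intro i s _
  by_cases hs : s ≤ f t i
  · filter_upwards [self_mem_nhdsWithin] with u hu
    exact iff_of_true (hs.trans (hf (le_of_lt hu) i)) hs
  · filter_upwards [(hcont i).eventually_lt_const (not_le.1 hs)] with u hu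
    exact iff_of_false (not_le.2 hu) hs

theorem eventually_corner_corner_add_eq (S : Finset ℝ≥0) {c : ℝ≥0 → Grade r} (hmono : Monotone c)
    {δ : ℝ≥0} (hcont : ∀ i, ContinuousWithinAt (fun ε => c ε i) (Set.Ioi δ) δ) :
    ∀ᶠ ε in 𝓝[>] δ, ∀ a : Grade r,
      corner S (corner S a + c ε) = corner S (corner S a + c δ) := by
  have hcorners : ∀ᶠ ε in 𝓝[>] δ, ∀ b ∈ Set.range (corner S : Grade r → Grade r),
      corner S (b + c ε) = corner S (b + c δ) :=
    (Filter.eventually_all_finite (finite_range_corner S)).2 fun b _ =>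
      eventually_corner_eq S (fun _ _ h => add_le_add_right (hmono h) b) fun i =>
        continuousWithinAt_const.add (hcont i)
  exact hcorners.mono fun ε hε a => hε _ ⟨a, rfl⟩

end Grid

section GridConstant

variable {S T : Finset ℝ≥0} {L M N : PersMod K r}

/-- `M` is constant on the cells of the grid with walls at `S`: structure maps within a cell are
isomorphisms. -/
def IsGridConstant (S : Finset ℝ≥0) (M : PersMod K r) : Prop :=
  ∀ ⦃a b : Grade r⦄ (h : a ≤ b), corner S a = corner S b → Function.Bijective (transition M h)

theorem IsGridConstant.mono (hM : IsGridConstant S M) (hST : S ⊆ T) : IsGridConstant T M :=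
  fun _ _ h hab => hM h <| corner_eq_corner_iff.2 fun i s hs =>
    corner_eq_corner_iff.1 hab i s (hST hs)

theorem IsGridConstant.surjective_transition_corner (hM : IsGridConstant S M) (a : Grade r) :
    Function.Surjective (transition M (corner_le S a)) :=
  (hM _ (corner_corner S a)).2

theorem isGridConstant_freeMod {k : ℕ} {g : Fin k → Grade r} (hg : ∀ i, corner S (g i) = g i) :
    IsGridConstant S (freeMod K g) := by
  refine fun a b h hab => ⟨Submodule.inclusion_injective (freeFiber_mono g h), fun x => ?_⟩
  have hle (i : Fin k) (hi : g i ≤ b) : g i ≤ a := calc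
    g i = corner S (g i) := (hg i).symm
    _ ≤ corner S b := corner_mono S hi
    _ = corner S a := hab.symm
    _ ≤ a := corner_le S a
  exact ⟨⟨x.1, fun i hi => x.2 i fun hib => hi (hle i hib)⟩, rfl⟩

theorem IsGridConstant.of_exact (hL : IsGridConstant S L) (hM : IsGridConstant S M) {q : L ⟶ M}
    {p : M ⟶ N} (hp : IsSurj p)
    (hqp : ∀ h, LinearMap.range (q.app h).hom = LinearMap.ker (p.app h).hom) :
    IsGridConstant S N := by
  refine fun a b h hab => ⟨(injective_iff_map_eq_zero _).2 fun x hx => ?_, fun x => ?_⟩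
  · obtain ⟨y, rfl⟩ := hp a x
    rw [← app_transition] at hx
    obtain ⟨z, hz⟩ := (hqp b).ge hx
    obtain ⟨z, rfl⟩ := (hL h hab).2 z
    rw [app_transition] at hz
    exact (hqp a).le ⟨z, (hM h hab).1 hz⟩
  · obtain ⟨y, rfl⟩ := hp b x
    obtain ⟨y, rfl⟩ := (hM h hab).2 y
    exact ⟨(p.app a).hom y, (app_transition p h y).symm⟩

theorem IsGridConstant.of_mono (hN : IsGridConstant S N) (f : M ⟶ N) [Mono f]
    (hf : ∀ ⦃a b : Grade r⦄ (h : a ≤ b), corner S a = corner S b → ∀ x,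
      transition N h x ∈ LinearMap.range (f.app b).hom → x ∈ LinearMap.range (f.app a).hom) :
    IsGridConstant S M := by
  refine fun a b h hab => ⟨fun x y hxy => ?_, fun x => ?_⟩
  · apply injective_app_of_mono f a
    apply (hN h hab).1
    rw [← app_transition, ← app_transition, hxy]
  · obtain ⟨y, hy⟩ := (hN h hab).2 ((f.app b).hom x)
    obtain ⟨z, rfl⟩ := hf h hab y ⟨x, hy.symm⟩
    exact ⟨z, injective_app_of_mono f b ((app_transition f h z).trans hy)⟩

theorem IsGridConstant.kernel (hM : IsGridConstant S M) (hN : IsGridConstant S N) (f : M ⟶ N) :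
    IsGridConstant S (Limits.kernel f) := by
  refine hM.of_mono (Limits.kernel.ι f) fun a b h hab x hx => ?_
  rw [range_kernel_ι_app, LinearMap.mem_ker] at hx ⊢
  apply (hN h hab).1
  rw [← app_transition, hx, map_zero]

theorem IsGridConstant.mem_generated_of_transition_mem (hM : IsGridConstant S M) {k : ℕ}
    {g : Fin k → Grade r} (hg : ∀ i, corner S (g i) = g i) {m : ∀ i, M.obj (g i)}
    {a b : Grade r} (h : a ≤ b) (hab : corner S a = corner S b) {x : M.obj a}
    (hx : transition M h x ∈ (generated M g m).fiber b) : x ∈ (generated M g m).fiber a := by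
  have hle : (generated M g m).fiber b ≤ ((generated M g m).fiber a).map (transition M h) := by
    refine generated_fiber_le fun i hi => ?_
    have hia : g i ≤ a := by
      rw [← hg i]
      exact (corner_mono S hi).trans (hab ▸ corner_le S a)
    exact ⟨_, transition_mem_generated m i hia, transition_transition _ _ _ _⟩
  obtain ⟨y, hy, hyx⟩ := hle hx
  rwa [← (hM h hab).1 hyx]

theorem IsGridConstant.generated (hM : IsGridConstant S M) {k : ℕ} {g : Fin k → Grade r}
    (hg : ∀ i, corner S (g i) = g i) (m : ∀ i, M.obj (g i)) :
    IsGridConstant S (generated M g m).toMod := by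
  refine hM.of_mono (MultiPers.generated M g m).ι fun a b h hab x hx => ?_
  rw [PersSub.range_ι_app] at hx ⊢
  exact hM.mem_generated_of_transition_mem hg h hab hx

theorem IsGridConstant.exists_generated_le (hM : IsGridConstant S M) {k : ℕ}
    (g : Fin k → Grade r) (m : ∀ i, M.obj (g i)) :
    ∃ m' : ∀ i, M.obj (corner S (g i)), ∀ h,
      (MultiPers.generated M g m).fiber h ≤
        (MultiPers.generated M (fun i => corner S (g i)) m').fiber h := by
  choose m' hm' using fun i => hM.surjective_transition_corner (g i) (m i)
  refine ⟨m', fun h => generated_fiber_le fun i hi => ?_⟩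
  rw [← hm', transition_transition]
  exact transition_mem_generated (g := fun i => corner S (g i)) m' i _

theorem IsGridConstant.exists_isSurj (hM : IsGridConstant S M)
    (hfin : ∀ a, Module.Finite K (M.obj a)) :
    ∃ (k : ℕ) (g : Fin k → Grade r) (p : freeMod K g ⟶ M),
      IsSurj p ∧ ∀ i, corner S (g i) = g i := by
  choose n s hs using fun a => Module.Finite.exists_fin (R := K) (M := M.obj a)
  have := (finite_range_corner (r := r) S).fintype
  let e := Fintype.equivFin (Σ b : Set.range (corner S : Grade r → Grade r), Fin (n b.1))
  let g j := (e.symm j).1.1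
  let m j : M.obj (g j) := s (e.symm j).1.1 (e.symm j).2
  have hmem (h : Grade r) (z : Σ b : Set.range (corner S : Grade r → Grade r), Fin (n b.1))
      (hz : z.1.1 ≤ h) : transition M hz (s z.1.1 z.2) ∈ (MultiPers.generated M g m).fiber h := by
    obtain ⟨j, rfl⟩ := e.symm.surjective z
    exact transition_mem_generated m j hz
  obtain ⟨p, hp⟩ := (exists_isSurj_iff g).2 ⟨m, fun h => eq_top_iff.2 fun x _ => by
    obtain ⟨y, rfl⟩ := hM.surjective_transition_corner h x
    have hy : y ∈ Submodule.span K (Set.range (s (corner S h))) := hs _ ▸ Submodule.mem_top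
    rw [← Submodule.mem_comap]
    refine Submodule.span_le.2 ?_ hy
    rintro _ ⟨t, rfl⟩
    exact hmem h ⟨⟨corner S h, h, rfl⟩, t⟩ (corner_le S h)⟩
  refine ⟨_, g, p, hp, fun j => ?_⟩
  obtain ⟨a, ha⟩ := (e.symm j).1.2
  change corner S (e.symm j).1.1 = (e.symm j).1.1
  rw [← ha, corner_corner]

end GridConstant

section Tame

variable {M N : PersMod K r}

theorem finite_of_isSurj (hfin : ∀ a, Module.Finite K (M.obj a)) {p : M ⟶ N} (hp : IsSurj p)
    (a : Grade r) : Module.Finite K (N.obj a) :=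
  have := hfin a
  Module.Finite.of_surjective (p.app a).hom (hp a)

theorem finite_of_mono (hfin : ∀ a, Module.Finite K (N.obj a)) (f : M ⟶ N) [Mono f]
    (a : Grade r) : Module.Finite K (M.obj a) :=
  have := hfin a
  Module.Finite.of_injective (f.app a).hom (injective_app_of_mono f a)

theorem finite_freeMod {k : ℕ} (g : Fin k → Grade r) (a : Grade r) :
    Module.Finite K ((freeMod K g).obj a) :=
  inferInstanceAs (Module.Finite K (freeFiber K g a))

theorem IsGridConstant.isTame {S : Finset ℝ≥0} (hM : IsGridConstant S M)
    (hfin : ∀ a, Module.Finite K (M.obj a)) : IsTame M := by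
  obtain ⟨n, g, p, hp, hg⟩ := hM.exists_isSurj hfin
  obtain ⟨m, g', q, hq, -⟩ := ((isGridConstant_freeMod hg).kernel hM p).exists_isSurj
    (finite_of_mono (finite_freeMod g) (Limits.kernel.ι p))
  refine ⟨n, m, g, g', q ≫ Limits.kernel.ι p, p, hp, fun h => ?_⟩
  rw [← range_kernel_ι_app]
  exact LinearMap.range_comp_of_range_eq_top _ (LinearMap.range_eq_top.2 (hq h))

theorem IsTame.finite (hM : IsTame M) (a : Grade r) : Module.Finite K (M.obj a) := by
  obtain ⟨n, m, g, g', q, p, hp, -⟩ := hM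
  exact finite_of_isSurj (finite_freeMod g) hp a

theorem IsTame.exists_isGridConstant (hM : IsTame M) : ∃ S, IsGridConstant S M := by
  classical
  obtain ⟨n, m, g, g', q, p, hp, hqp⟩ := hM
  obtain ⟨S, hS⟩ := exists_finset_forall_corner_eq g
  obtain ⟨S', hS'⟩ := exists_finset_forall_corner_eq g'
  exact ⟨S ∪ S', (isGridConstant_freeMod (hS' _ Finset.subset_union_right)).of_exact
    (isGridConstant_freeMod (hS _ Finset.subset_union_left)) hp hqp⟩

theorem IsTame.generated (hM : IsTame M) {k : ℕ} (g : Fin k → Grade r) (m : ∀ i, M.obj (g i)) :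
    IsTame (generated M g m).toMod := by
  classical
  obtain ⟨S, hS⟩ := hM.exists_isGridConstant
  obtain ⟨T, hT⟩ := exists_finset_forall_corner_eq g
  exact ((hS.mono Finset.subset_union_left).generated (hT _ Finset.subset_union_right) m).isTame
    (finite_of_mono hM.finite (MultiPers.generated M g m).ι)

theorem IsTame.cokernel (hM : IsTame M) (hN : IsTame N) (f : M ⟶ N) :
    IsTame (Limits.cokernel f) := by
  classical
  obtain ⟨S, hS⟩ := hM.exists_isGridConstant
  obtain ⟨T, hT⟩ := hN.exists_isGridConstant
  exact ((hS.mono Finset.subset_union_left).of_exact (hT.mono Finset.subset_union_right)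
    (cokernel_π_isSurj f) (range_app_eq_ker_cokernel_π f)).isTame
    (finite_of_isSurj hN.finite (cokernel_π_isSurj f))

theorem isTame_of_isZero (hM : Limits.IsZero M) : IsTame M := by
  have hsub (a : Grade r) : Subsingleton (M.obj a) :=
    ModuleCat.subsingleton_of_isZero (hM.obj a)
  exact IsGridConstant.isTame (S := ∅) (fun a b _ _ =>
    ⟨Function.injective_of_subsingleton _, Function.surjective_to_subsingleton _⟩)
    fun _ => inferInstance

end Tame

section ShiftDim

variable {L M N : PersMod K r} {k : ℕ}

theorem transition_app_mem_map_generated {f : M ⟶ L} {g : N ⟶ L} {b : Grade r}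
    {γ : Fin k → Grade r} {n : ∀ i, N.obj (γ i)} {m : ∀ i, M.obj (γ i + b)}
    (hm : ∀ i, (f.app _).hom (m i) = transition L le_self_add ((g.app _).hom (n i)))
    {s : Grade r} {y : N.obj s} (hy : y ∈ (generated N γ n).fiber s) :
    transition L (le_self_add : s ≤ s + b) ((g.app s).hom y) ∈
      ((generated M (fun i => γ i + b) m).fiber (s + b)).map (f.app (s + b)).hom := by
  suffices hle : (generated N γ n).fiber s ≤
      (((generated M (fun i => γ i + b) m).fiber (s + b)).map (f.app (s + b)).hom).comap
        (transition L le_self_add ∘ₗ (g.app s).hom) from hle hy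
  refine generated_fiber_le fun i hi => ?_
  have hib : γ i + b ≤ s + b := add_le_add_left hi b
  refine ⟨_, transition_mem_generated (g := fun i => γ i + b) m i hib, ?_⟩
  rw [app_transition, hm, LinearMap.comp_apply, app_transition, transition_transition,
    transition_transition]

theorem exists_vGenerate_of_shiftZero {f : M ⟶ L} {g : N ⟶ L} {a b d : Grade r}
    (hker : ShiftZero a (Limits.kernel f)) (hcoker : ShiftZero b (Limits.cokernel f))
    (hcoker' : ShiftZero d (Limits.cokernel g)) {γ : Fin k → Grade r} {n : ∀ i, N.obj (γ i)}
    (hn : ∀ h, (generated N γ n).fiber h = ⊤) :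
    ∃ m : ∀ i, M.obj (γ i + b), VGenerate (d + b + a) M (fun i => γ i + b) m := by
  choose m hm using fun i => shiftZero_cokernel_iff.1 hcoker _ ((g.app _).hom (n i))
  refine ⟨m, vGenerate_iff.2 fun s x => ?_⟩
  obtain ⟨y, hy⟩ := shiftZero_cokernel_iff.1 hcoker' s ((f.app s).hom x)
  have hfx := transition_app_mem_map_generated hm ((hn _).ge (Submodule.mem_top : y ∈ ⊤))
  rw [hy, transition_transition, ← app_transition] at hfx
  have hx := PersSub.transition_mem_of_app_mem_map _ hker hfx
  have hle : s + d + b + a ≤ s + (d + b + a) := by simp only [add_assoc, le_refl]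
  simpa only [transition_transition] using PersSub.transition_mem _ hle hx

theorem IsGridConstant.vGenerate {S : Finset ℝ≥0} (hM : IsGridConstant S M) {u v : Grade r}
    (huv : u ≤ v) (hcell : ∀ a : Grade r, corner S (corner S a + u) = corner S (corner S a + v))
    {g : Fin k → Grade r} (hg : ∀ i, corner S (g i) = g i) {m : ∀ i, M.obj (g i)}
    (hm : VGenerate v M g m) : VGenerate u M g m := by
  refine vGenerate_iff.2 fun a x => ?_
  obtain ⟨y, rfl⟩ := hM.surjective_transition_corner a x
  have hle : corner S a + u ≤ corner S a + v := add_le_add_right huv _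
  have hy : transition M (le_self_add : corner S a ≤ corner S a + u) y ∈
      (MultiPers.generated M g m).fiber (corner S a + u) := by
    apply hM.mem_generated_of_transition_mem hg hle (hcell a)
    rw [transition_transition]
    exact vGenerate_iff.1 hm _ y
  have hya := PersSub.transition_mem _ (add_le_add_left (corner_le S a) u) hy
  rwa [transition_transition] at hya ⊢

theorem IsTame.eventually_shiftDim_le (hM : IsTame M) {c : ℝ≥0 → Grade r} (hmono : Monotone c)
    {δ : ℝ≥0} (hcont : ∀ i, ContinuousWithinAt (fun ε => c ε i) (Set.Ioi δ) δ) :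
    ∀ᶠ ε in 𝓝[>] δ, shiftDim (c δ) M ≤ shiftDim (c ε) M := by
  obtain ⟨S, hS⟩ := hM.exists_isGridConstant
  filter_upwards [eventually_corner_corner_add_eq S hmono hcont, self_mem_nhdsWithin]
    with ε hcell hδε
  obtain ⟨g, m, hm⟩ := hM.exists_vGenerate_shiftDim (c ε)
  obtain ⟨m', hm'⟩ := hS.exists_generated_le g m
  have hcorner : VGenerate (c ε) M (fun i => corner S (g i)) m' :=
    vGenerate_iff.2 fun a x => hm' _ (vGenerate_iff.1 hm a x)
  exact shiftDim_le <| hS.vGenerate (hmono (le_of_lt hδε)) (fun a => (hcell a).symm)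
    (fun i => corner_corner S (g i)) hcorner

end ShiftDim

section Noise

theorem mem_contourNoise_of_isZero (C : Contour r) (ε : ℝ≥0) {N : PersMod K r}
    (hN : Limits.IsZero N) : N ∈ contourNoise K C ε :=
  ⟨isTame_of_isZero hN, fun x _ _ _ => (hN.obj x).eq_of_src _ _⟩

theorem isZero_kernel_of_mono {M N : PersMod K r} (f : M ⟶ N) [Mono f] :
    Limits.IsZero (Limits.kernel f) :=
  (Limits.isZero_zero _).of_iso (Limits.kernel.ofMono f)

theorem isZero_cokernel_of_epi {M N : PersMod K r} (f : M ⟶ N) [Epi f] :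
    Limits.IsZero (Limits.cokernel f) :=
  (Limits.isZero_zero _).of_iso (Limits.cokernel.ofEpi f)

theorem isEquivalence_of_mono (C : Contour r) {ε : ℝ≥0} {M N : PersMod K r} (f : M ⟶ N) [Mono f]
    (hf : Limits.cokernel f ∈ contourNoise K C ε) : IsEquivalence (contourNoise K C) ε f :=
  ⟨0, ε, (zero_add ε).le, mem_contourNoise_of_isZero C 0 (isZero_kernel_of_mono f), hf⟩

theorem areEquivalent_of_noiseDist_lt {V : ℝ≥0 → Set (PersMod K r)} {M N : TameMod K r} {ε : ℝ≥0}
    (h : noiseDist V M N < ε) : AreEquivalent V ε M N := by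
  simp only [noiseDist, iInf_lt_iff, ENNReal.coe_lt_coe] at h
  obtain ⟨η, ⟨L, f, g, ε₁, ε₂, hf, hg, hη⟩, hlt⟩ := h
  exact ⟨L, f, g, ε₁, ε₂, hf, hg, hη.trans hlt.le⟩

/-- The contour `C` is the translation `C(x, ε) = x + c(ε)` along the curve `c`; the standard
contour in the direction of `v` is the case `c(ε) = ε v`. -/
def Contour.IsTranslation (C : Contour r) (c : ℝ≥0 → Grade r) : Prop :=
  ∀ (x : Grade r) (ε : ℝ≥0),
    C.toFun (x : WithTop (Grade r)) ε = ((x + c ε : Grade r) : WithTop (Grade r))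

namespace Contour.IsTranslation

variable {C : Contour r} {c : ℝ≥0 → Grade r} (hC : C.IsTranslation c)
include hC

theorem monotone : Monotone c := by
  intro ε τ h
  have := C.mono (le_refl ((0 : Grade r) : WithTop (Grade r))) h
  simpa only [hC _ _, WithTop.coe_le_coe, zero_add] using this

theorem add_le (ε τ : ℝ≥0) : c ε + c τ ≤ c (ε + τ) := by
  have := C.lax ((0 : Grade r) : WithTop (Grade r)) ε τ
  simpa only [hC _ _, WithTop.coe_le_coe, zero_add] using this

theorem mem_contourNoise_iff {ε : ℝ≥0} {N : PersMod K r} :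
    N ∈ contourNoise K C ε ↔ IsTame N ∧ ShiftZero (c ε) N := by
  refine and_congr_right fun _ => ⟨fun h a => h a _ _ (hC a ε), fun h a b hab hb => ?_⟩
  obtain rfl : a + c ε = b := WithTop.coe_injective ((hC a ε).symm.trans hb)
  exact h a

theorem shiftDim_le_betti0 {ε : ℝ≥0} {M N : TameMod K r}
    (h : AreEquivalent (contourNoise K C) ε M N) : shiftDim (c ε) M.1 ≤ betti0 N.1 := by
  obtain ⟨L, f, g, ε₁, ε₂, ⟨a, b, hab, hker, hcoker⟩, ⟨a', d, had, -, hcoker'⟩, hε⟩ := h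
  obtain ⟨γ, n, hn⟩ := N.2.exists_generated_betti0
  obtain ⟨m, hm⟩ := exists_vGenerate_of_shiftZero (hC.mem_contourNoise_iff.1 hker).2
    (hC.mem_contourNoise_iff.1 hcoker).2 (hC.mem_contourNoise_iff.1 hcoker').2 hn
  have hshift : c d + c b + c a ≤ c ε := calc
    c d + c b + c a ≤ c (d + b + a) :=
      (add_le_add_left (hC.add_le d b) (c a)).trans (hC.add_le (d + b) a)
    _ ≤ c ε := hC.monotone <| calc
      d + b + a = a + b + d := by ring
      _ ≤ ε₁ + ε₂ := add_le_add hab (le_add_self.trans had)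
      _ ≤ ε := hε
  exact shiftDim_le (hm.mono hshift)

theorem shiftDim_le_betti0_of_noiseDist_le {δ : ℝ≥0}
    (hcont : ∀ i, ContinuousWithinAt (fun ε => c ε i) (Set.Ioi δ) δ) {M N : TameMod K r}
    (h : noiseDist (contourNoise K C) M N ≤ δ) : shiftDim (c δ) M.1 ≤ betti0 N.1 := by
  obtain ⟨ε, hle, hδε⟩ :=
    ((M.2.eventually_shiftDim_le hC.monotone hcont).and self_mem_nhdsWithin).exists
  have hlt : noiseDist (contourNoise K C) M N < ε := h.trans_lt (ENNReal.coe_lt_coe.2 hδε)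
  exact hle.trans (hC.shiftDim_le_betti0 (areEquivalent_of_noiseDist_lt hlt))

theorem noiseDist_generated_le {δ : ℝ≥0} (M : TameMod K r) {k : ℕ} {g : Fin k → Grade r}
    {m : ∀ i, M.1.obj (g i)} (hm : VGenerate (c δ) M.1 g m) :
    noiseDist (contourNoise K C) M ⟨(generated M.1 g m).toMod, M.2.generated g m⟩ ≤ δ := by
  have hcoker : Limits.cokernel (generated M.1 g m).ι ∈ contourNoise K C δ :=
    hC.mem_contourNoise_iff.2 ⟨(M.2.generated g m).cokernel M.2 _,
      (generated M.1 g m).shiftZero_cokernel_ι_iff.2 hm⟩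
  have hid : IsEquivalence (contourNoise K C) 0 (𝟙 M.1) :=
    isEquivalence_of_mono C _ (mem_contourNoise_of_isZero C 0 (isZero_cokernel_of_epi _))
  exact iInf₂_le δ ⟨M, 𝟙 M.1, (generated M.1 g m).ι, 0, δ, hid,
    isEquivalence_of_mono C _ hcoker, (zero_add δ).le⟩

theorem exists_noiseDist_le_and_betti0_le (M : TameMod K r) (δ : ℝ≥0) :
    ∃ N : TameMod K r, noiseDist (contourNoise K C) M N ≤ δ ∧
      betti0 N.1 ≤ shiftDim (c δ) M.1 := by
  obtain ⟨g, m, hm⟩ := M.2.exists_vGenerate_shiftDim (c δ)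
  exact ⟨_, hC.noiseDist_generated_le M hm, betti0_le (generated_generatedGen_fiber_eq_top m)⟩

end Contour.IsTranslation

end Noise

end MultiPers

theorem mainTheorem1_general {K : Type u} [Field K] {r : ℕ} {C : MultiPers.Contour r}
    {c : ℝ≥0 → MultiPers.Grade r} (hC : C.IsTranslation c) (M : MultiPers.TameMod K r) {δ : ℝ≥0}
    (hcont : ∀ i, ContinuousWithinAt (fun ε => c ε i) (Set.Ioi δ) δ) :
    MultiPers.hierStab (MultiPers.noiseDist (MultiPers.contourNoise K C))
        (fun N : MultiPers.TameMod K r => MultiPers.betti0 N.1) M δ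
      = MultiPers.shiftDim (c δ) M.1 := by
  obtain ⟨N, hN, hle⟩ := hC.exists_noiseDist_le_and_betti0_le M δ
  refine le_antisymm (le_trans (Nat.sInf_le ⟨N, hN, rfl⟩) hle) ?_
  refine le_csInf ⟨MultiPers.betti0 N.1, N, hN, rfl⟩ ?_
  rintro _ ⟨N', hN', rfl⟩
  exact hC.shiftDim_le_betti0_of_noiseDist_le hcont hN'

theorem mainTheorem1 {K : Type u} [Field K] {r : ℕ}
    (nrm : Seminorm ℝ (Fin r → ℝ)) (hnrm : ∀ x : Fin r → ℝ, nrm x = 0 → x = 0)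
    (w : MultiPers.Grade r) (hw : w ≠ 0) (v : MultiPers.Grade r)
    (hv : v = MultiPers.normalize nrm w)
    (M : MultiPers.TameMod K r) (δ : ℝ≥0) :
    MultiPers.hierStab
        (MultiPers.noiseDist (MultiPers.standardNoise K v))
        (fun N : MultiPers.TameMod K r => MultiPers.betti0 N.1) M δ
      = MultiPers.shiftDim (δ • v) M.1 :=
  mainTheorem1_general (C := MultiPers.standardContour v) (c := fun ε => ε • v)
    (fun _ _ => rfl) M fun i => (continuous_mul_const (v i)).continuousWithinAt
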